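/- Let $\mathbb F=\mathbb R$ or $\mathbb C$ and write $[m]=\{1,\dots,m\}$. Definitions. A symmetric $(m,l,\lambda)$ block design is a set $\mathbb S$ of exactly $m$ subsets of $[m]$ (blocks), each of size $l$, such that every two-element subset of $[m]$ lies in exactly $\lambda$ blocks and all elements of $[m]$ lie in the same number of blocks; its complement is $\mathbb S^c=\{[m]\setminus\mathcal J:\mathcal J\in\mathbb S\}$. Orthonormal bases $\mathcal B_k=\{b^{(k)}_j\}_{j=1}^m$ $(k\in K)$ of $\mathbb F^m$ are mutually unbiased bases (MUBs) if $|\langle b^{(k)}_j,b^{(k')}_{j'}\rangle|^2=\frac1m$ for all $k\ne k'$ and all $j,j'$; a set of MUBs is called maximal if $|K|=m/2+1$ (for $\mathbb F=\mathbb R$), respectively $|K|=m+1$ (for $\mathbb F=\mathbb C$). For $\mathcal J\subset[m]$ put $P^{\mathcal B_k}_{\mathcal J}=\sum_{j\in\mathcal J}b^{(k)}_j(b^{(k)}_j)^*$. A packing for $\mathbb F^m$ is a finite family $\mathcal P=\{P_i\}_{i\in I}$ of non-zero orthogonal projections on $\mathbb F^m$; its mixture is the number of different ranks of the $P_i$,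 and it is mixed-rank if its mixture is not $1$. It is tight if $\sum_i P_i$ is a positive multiple of the identity $I_m$. For $0<l<m$ let $\mathcal K_l$ be the set of the matrices $\sqrt{\frac{m}{l(m-l)}}\,\bigl(P-\frac lm I_m\bigr)$ with $P$ an orthogonal projection of rank $l$ on $\mathbb F^m$; these are unit vectors of the real space of traceless self-adjoint $m\times m$ matrices over $\mathbb F$ with the inner product $\langle A,B\rangle=\operatorname{tr}(AB)$. The embedded vector of a projection $P_i$ of rank $l_i$, $0<l_i<m$, is $v_i=\sqrt{\frac{m}{l_i(m-l_i)}}\,\bigl(P_i-\frac{l_i}m I_m\bigr)\in\mathcal K_{l_i}$. A packing all of whose ranks $l_i$ satisfy $0<l_i<m$ is optimally spread if $$\max_{i\ne j}\langle v_i,v_j\rangle=\min_{(u_i)\in\prod_i\mathcal K_{l_i}}\ \max_{i\ne j}\langle u_i,u_j\rangle .$$ Statement. (1) Let $m=4^a$ with $a\ge1$. Then there is a maximal set of MUBs in $\mathbb R^m$, and for every maximal set of MUBs $\{\mathcal B_k\}_{k=1}^{m/2+1}$ in $\mathbb R^m$, every symmetric block design $\mathbb S$ on $[m]$ and every partition $\{A_1,A_2\}$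 of $[m/2+1]$ into two non-empty sets, the family $$\{P^{\mathcal B_k}_{\mathcal J}:k\in A_1,\ \mathcal J\in\mathbb S\}\cup\{P^{\mathcal B_k}_{\mathcal J}:k\in A_2,\ \mathcal J\in\mathbb S^c\}$$ is a tight optimally spread mixed-rank packing with a mixture of $2$ for $\mathbb R^m$. (2) Let $m$ be a prime power. Then there is a maximal set of MUBs in $\mathbb C^m$. If $m\neq2$, then for every maximal set of MUBs $\{\mathcal B_k\}_{k=1}^{m+1}$ in $\mathbb C^m$, every symmetric block design $\mathbb S$ on $[m]$ and every partition $\{A_1,A_2\}$ of $[m+1]$ into two non-empty sets, the family $$\{P^{\mathcal B_k}_{\mathcal J}:k\in A_1,\ \mathcal J\in\mathbb S\}\cup\{P^{\mathcal B_k}_{\mathcal J}:k\in A_2,\ \mathcal J\in\mathbb S^c\}$$ is a tight optimally spread mixed-rank packing with a mixture of $2$ for $\mathbb C^m$. -/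

import Mathlib

noncomputable section

namespace MixedPacking

open Matrix
open scoped ComplexOrder

/-! ### Packings, mixture, tight fusion frames -/

/-- The Grassmannian `G(l, 𝕜^m)`: the orthogonal projections of rank `l` on `𝕜^m`, as matrices. -/
def Grassmannian (𝕜 : Type*) [RCLike 𝕜] (m l : ℕ) : Set (Matrix (Fin m) (Fin m) 𝕜) :=
  {P | IsStarProjection P ∧ P.rank = l}

/-- A packing for `𝕜^m`: a finite family of orthogonal projections of rank between `1` and `m`. -/
def IsPacking {𝕜 : Type*} [RCLike 𝕜] {m : ℕ} {ι : Type*}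
    (P : ι → Matrix (Fin m) (Fin m) 𝕜) : Prop :=
  ∀ i, IsStarProjection (P i) ∧ 1 ≤ (P i).rank ∧ (P i).rank ≤ m

/-- The mixture of a packing: the number of different ranks among its elements. -/
def mixture {𝕜 : Type*} [RCLike 𝕜] {m : ℕ} {ι : Type*} [Fintype ι]
    (P : ι → Matrix (Fin m) (Fin m) 𝕜) : ℕ :=
  (Finset.univ.image fun i => (P i).rank).card

/-- A packing is a tight fusion frame if its fusion frame operator `∑ i, P i` is positive definite
and a multiple of the identity. -/
def IsTightFusionFrame {𝕜 : Type*} [RCLike 𝕜] {m : ℕ} {ι : Type*} [Fintype ι]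
    (P : ι → Matrix (Fin m) (Fin m) 𝕜) : Prop :=
  (∑ i, P i).PosDef ∧ ∃ c : 𝕜, ∑ i, P i = c • (1 : Matrix (Fin m) (Fin m) 𝕜)

/-! ### The embedding into the unit sphere of the traceless Hermitian matrices -/

/-- The Hilbert-Schmidt inner product. On the real vector space of Hermitian matrices
it is `tr (A B)`. -/
def hsInner {𝕜 : Type*} [RCLike 𝕜] {m : ℕ} (A B : Matrix (Fin m) (Fin m) 𝕜) : ℝ :=
  RCLike.re (Aᴴ * B).trace

/-- The radius `r_l = √(l (m - l) / m)`. -/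
def radius (m l : ℕ) : ℝ :=
  Real.sqrt ((l : ℝ) * ((m : ℝ) - (l : ℝ)) / (m : ℝ))

/-- The normalized traceless map `P ↦ (P - (l / m) I) / r_l`, for `P` of rank `l`, `0 < l < m`.
Its values are unit vectors of the Euclidean space of traceless Hermitian matrices. -/
def embed {𝕜 : Type*} [RCLike 𝕜] {m : ℕ} (l : ℕ) (P : Matrix (Fin m) (Fin m) 𝕜) :
    Matrix (Fin m) (Fin m) 𝕜 :=
  (((radius m l)⁻¹ : ℝ) : 𝕜) • (P - ((l : 𝕜) / (m : 𝕜)) • (1 : Matrix (Fin m) (Fin m) 𝕜))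

/-- The image `K_l` of the Grassmannian `G(l, 𝕜^m)` in the unit sphere. -/
def embeddedGrassmannian (𝕜 : Type*) [RCLike 𝕜] (m l : ℕ) : Set (Matrix (Fin m) (Fin m) 𝕜) :=
  embed l '' Grassmannian 𝕜 m l

/-- The inner products of the pairs of elements of a family with different indices. -/
def pairInners {𝕜 : Type*} [RCLike 𝕜] {m : ℕ} {ι : Type*}
    (u : ι → Matrix (Fin m) (Fin m) 𝕜) : Set ℝ :=
  {x | ∃ i j, i ≠ j ∧ hsInner (u i) (u j) = x}

/-- A packing is optimally spread if its elements have embedded vectors (ranks strictly between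
`0` and `m`) and the maximal inner product of these vectors is the least one among all families
with the same index set and with `u i` in `K_l`, `l` the rank of `P i`. -/
def IsOptimallySpread {𝕜 : Type*} [RCLike 𝕜] {m : ℕ} {ι : Type*}
    (P : ι → Matrix (Fin m) (Fin m) 𝕜) : Prop :=
  (∀ i, 0 < (P i).rank ∧ (P i).rank < m) ∧
  ∃ μ : ℝ, IsGreatest (pairInners fun i => embed (P i).rank (P i)) μ ∧
    IsLeast {ν : ℝ | ∃ u : ι → Matrix (Fin m) (Fin m) 𝕜,
      (∀ i, u i ∈ embeddedGrassmannian 𝕜 m (P i).rank) ∧ IsGreatest (pairInners u) ν} μ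

/-! ### Mutually unbiased bases and coordinate projections -/

/-- A family of orthonormal bases of `𝕜^m` is mutually unbiased. -/
def IsMUB {𝕜 : Type*} [RCLike 𝕜] {m : ℕ} {κ : Type*}
    (B : κ → OrthonormalBasis (Fin m) 𝕜 (EuclideanSpace 𝕜 (Fin m))) : Prop :=
  ∀ k k', k ≠ k' → ∀ j j', ‖inner 𝕜 (B k j) (B k' j')‖ ^ 2 = 1 / (m : ℝ)

/-- The coordinate projection `∑ j ∈ J, b_j b_j^*`. -/
def coordProj {𝕜 : Type*} [RCLike 𝕜] {m : ℕ}
    (b : OrthonormalBasis (Fin m) 𝕜 (EuclideanSpace 𝕜 (Fin m))) (J : Finset (Fin m)) :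
    Matrix (Fin m) (Fin m) 𝕜 :=
  ∑ j ∈ J, vecMulVec (fun i => b j i) (fun i => star (b j i))

/-! ### Block designs -/

/-- `S` is a `t`-`(m, l, lam)` block design on the points `Fin m`. -/
def IsBlockDesign {m : ℕ} (t l lam : ℕ) (S : Finset (Finset (Fin m))) : Prop :=
  (∀ J ∈ S, J.card = l) ∧
  (∀ T : Finset (Fin m), T.card = t → (S.filter fun J => T ⊆ J).card = lam) ∧
  ∃ r : ℕ, ∀ x : Fin m, (S.filter fun J => x ∈ J).card = r

/-- `S` is a symmetric `(m, l, lam)` block design: a `2`-design with as many blocks as points. -/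
def IsSymmetricDesign {m : ℕ} (l lam : ℕ) (S : Finset (Finset (Fin m))) : Prop :=
  IsBlockDesign 2 l lam S ∧ S.card = m

/-- The complement of a design: its blocks are the complements of the blocks of `S`. -/
def complDesign {m : ℕ} (S : Finset (Finset (Fin m))) : Finset (Finset (Fin m)) :=
  S.image fun J => Jᶜ

/-- `{A₁, A₂}` is a partition of the finite type `κ` into two parts. -/
def IsTwoPartition {κ : Type*} [Fintype κ] [DecidableEq κ] (A₁ A₂ : Finset κ) : Prop :=
  A₁.Nonempty ∧ A₂.Nonempty ∧ Disjoint A₁ A₂ ∧ A₁ ∪ A₂ = Finset.univ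

/-- The union of `{P_J^{B_k} : k ∈ A₁, J ∈ S₁}` and `{P_J^{B_k} : k ∈ A₂, J ∈ S₂}`, as a family. -/
def unionFamily {𝕜 : Type*} [RCLike 𝕜] {m : ℕ} {κ : Type*}
    (B : κ → OrthonormalBasis (Fin m) 𝕜 (EuclideanSpace 𝕜 (Fin m)))
    (A₁ A₂ : Finset κ) (S₁ S₂ : Finset (Finset (Fin m))) :
    (A₁ × S₁) ⊕ (A₂ × S₂) → Matrix (Fin m) (Fin m) 𝕜 :=
  Sum.elim (fun p => coordProj (B p.1) p.2) (fun p => coordProj (B p.1) p.2)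

/-- `P` is a tight optimally spread mixed-rank packing with a mixture of `s` (`s ≠ 1`). -/
def IsTightOptimalMixedPacking {𝕜 : Type*} [RCLike 𝕜] {m : ℕ} {ι : Type*} [Fintype ι]
    (P : ι → Matrix (Fin m) (Fin m) 𝕜) (s : ℕ) : Prop :=
  IsPacking P ∧ IsTightFusionFrame P ∧ IsOptimallySpread P ∧ mixture P = s ∧ s ≠ 1

end MixedPacking

end

/-!
The embedded vectors of the packing lie in the space of traceless self-adjoint matrices. A family
of vectors with pairwise negative inner products has at most one element more than the dimension
of the space, so a family `v` with more elements that satisfies `⟪v i, v j⟫ ≤ 0` for all `i ≠ j`,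
with equality for some pair, is optimally spread. For the coordinate projections of a set of
mutually unbiased bases, the inner product is `0` if the bases differ. If the bases agree, it is a
positive multiple of `m * |J ∩ K| - |J| * |K|`, which is at most `0` for distinct blocks of a
symmetric design by the classical identity `|J ∩ K| = lam`. Maximality of the set of bases makes
the family large enough.

The bases themselves consist of the vectors `x ↦ χ x * e (φ x) / √|V|`, where `V` is a finite
vector space, `φ` runs through its dual and `χ` is a quadratic exponential with polar form `β`. Two
such bases are unbiased if the difference of their polar forms is nondegenerate, by the evaluation
of Gauss sums. Over `ℂ` the forms `tr (s x y)` on a finite field serve, over `ℝ` (where `χ` can only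
have the values `1` and `-1`, so that `β` has to be alternating) the forms of a Kerdock set.
-/

noncomputable section

namespace MixedPacking

open Matrix Module
open scoped ComplexOrder

section Obtuse

variable {E ι : Type*} [AddCommGroup E] [Module ℝ E] [Fintype ι] {β : LinearMap.BilinForm ℝ E}

-- All but one of the vectors lie in the open half space opposite to the remaining one.
lemma card_le_finrank_add_one_of_pairwise_neg (hβ : β.toQuadraticMap.PosDef) {v : ι → E}
    (hneg : Pairwise fun i j => β (v i) (v j) < 0) {W : Submodule ℝ E} [FiniteDimensional ℝ W]
    (hv : ∀ i, v i ∈ W) : Fintype.card ι ≤ finrank ℝ W + 1 := by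
  classical
  rcases isEmpty_or_nonempty ι with _ | ⟨⟨i₀⟩⟩
  · simp
  have hli : LinearIndependent ℝ (fun i : {i // i ≠ i₀} => v i) :=
    β.linearIndependent_of_pairwise_le_zero hβ (-(β (v i₀))) _
      (fun i => neg_pos.2 (hneg i.2.symm))
      (fun i j hij => (hneg fun h => hij (Subtype.ext h)).le)
  have hliW : LinearIndependent ℝ (fun i : {i // i ≠ i₀} => (⟨v i, hv i⟩ : W)) :=
    LinearIndependent.of_comp W.subtype hli
  have hcard := hliW.fintype_card_le_finrank
  rw [Fintype.card_subtype_compl, Fintype.card_subtype_eq] at hcard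
  lia

end Obtuse

section SelfAdjointMatrix

variable (n : Type*) [Fintype n]

lemma finrank_selfAdjoint_matrix_real_le :
    finrank ℝ (selfAdjoint.submodule ℝ (Matrix n n ℝ)) ≤ (Fintype.card n + 1).choose 2 := by
  classical
  let upper : selfAdjoint.submodule ℝ (Matrix n n ℝ) →ₗ[ℝ] Sym2 n → ℝ :=
    { toFun := fun A => Sym2.lift ⟨fun i j => A.1 i j, fun i j => congrFun₂ A.2 j i⟩
      map_add' := fun A B => funext <| Sym2.ind fun i j => rfl
      map_smul' := fun c A => funext <| Sym2.ind fun i j => rfl }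
  have hinj : Function.Injective upper := fun A B hAB =>
    Subtype.ext <| Matrix.ext fun i j => congrFun hAB s(i, j)
  simpa [Sym2.card] using LinearMap.finrank_le_finrank_of_injective hinj

-- The map `A ↦ re A i j + im A i j` is injective on self-adjoint matrices, since conjugating
-- the entry changes the sign of its imaginary part.
lemma finrank_selfAdjoint_matrix_le (𝕜 : Type*) [RCLike 𝕜] :
    finrank ℝ (selfAdjoint.submodule ℝ (Matrix n n 𝕜)) ≤ Fintype.card n ^ 2 := by
  let entrySum : selfAdjoint.submodule ℝ (Matrix n n 𝕜) →ₗ[ℝ] n × n → ℝ :=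
    { toFun := fun A p => RCLike.re (A.1 p.1 p.2) + RCLike.im (A.1 p.1 p.2)
      map_add' := fun A B => funext fun p => by simp [add_add_add_comm]
      map_smul' := fun c A => funext fun p => by simp [RCLike.smul_re, RCLike.smul_im, mul_add] }
  have hinj : Function.Injective entrySum := by
    rw [← LinearMap.ker_eq_bot, LinearMap.ker_eq_bot']
    intro A hA
    refine Subtype.ext <| Matrix.ext fun i j => ?_
    have hij : RCLike.re (A.1 i j) + RCLike.im (A.1 i j) = 0 := congrFun hA (i, j)
    have hji : RCLike.re (A.1 j i) + RCLike.im (A.1 j i) = 0 := congrFun hA (j, i)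
    have hstar : A.1 j i = star (A.1 i j) := (congrFun₂ A.2 j i).symm
    rw [hstar, RCLike.star_def, RCLike.conj_re, RCLike.conj_im] at hji
    exact RCLike.ext (by simp; linarith) (by simp; linarith)
  simpa [sq] using LinearMap.finrank_le_finrank_of_injective hinj

end SelfAdjointMatrix

section OptimallySpread

variable {𝕜 : Type*} [RCLike 𝕜] {m : ℕ}

/-- The Hilbert-Schmidt inner product as a real bilinear form on all matrices. -/
def hsForm (𝕜 : Type*) [RCLike 𝕜] (m : ℕ) : LinearMap.BilinForm ℝ (Matrix (Fin m) (Fin m) 𝕜) :=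
  LinearMap.mk₂ ℝ hsInner
    (fun A B C => by simp [hsInner, add_mul])
    (fun c A B => by simp [hsInner, RCLike.smul_re])
    (fun A B C => by simp [hsInner, mul_add])
    (fun c A B => by simp [hsInner, RCLike.smul_re])

lemma posDef_hsForm : (hsForm 𝕜 m).toQuadraticMap.PosDef := fun A hA => by
  have hnonneg := (posSemidef_conjTranspose_mul_self A).trace_nonneg
  obtain ⟨hre, him⟩ := RCLike.nonneg_iff.1 hnonneg
  refine lt_of_le_of_ne hre fun hzero => hA ?_
  rw [← trace_conjTranspose_mul_self_eq_zero_iff]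
  exact RCLike.ext (hzero.symm.trans (map_zero _).symm) (him.trans (map_zero _).symm)

/-- The real space of traceless self-adjoint matrices. -/
def tracelessSelfAdjoint (𝕜 : Type*) [RCLike 𝕜] (m : ℕ) :
    Submodule ℝ (Matrix (Fin m) (Fin m) 𝕜) :=
  selfAdjoint.submodule ℝ _ ⊓ LinearMap.ker (traceLinearMap (Fin m) ℝ 𝕜)

lemma finrank_tracelessSelfAdjoint_lt (hm : m ≠ 0) :
    finrank ℝ (tracelessSelfAdjoint 𝕜 m) <
      finrank ℝ (selfAdjoint.submodule ℝ (Matrix (Fin m) (Fin m) 𝕜)) := by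
  refine Submodule.finrank_lt_finrank_of_lt <| SetLike.lt_iff_le_and_exists.2
    ⟨inf_le_left, 1, IsSelfAdjoint.one _, fun hone => hm ?_⟩
  simpa using hone.2

lemma trace_eq_rank_of_isIdempotentElem {n K : Type*} [Fintype n] [Field K]
    {P : Matrix n n K} (hP : IsIdempotentElem P) : P.trace = P.rank := by
  classical
  have hproj := LinearMap.IsIdempotentElem.isProj_range _ (hP.map (toLinAlgEquiv' (R := K)))
  rw [← trace_toLin'_eq, rank_eq_finrank_range_toLin P (Pi.basisFun K n) (Pi.basisFun K n)]
  exact hproj.trace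

lemma embed_mem_tracelessSelfAdjoint (hm : m ≠ 0) {P : Matrix (Fin m) (Fin m) 𝕜}
    (hP : IsStarProjection P) : embed P.rank P ∈ tracelessSelfAdjoint 𝕜 m := by
  have hm' : (m : 𝕜) ≠ 0 := Nat.cast_ne_zero.2 hm
  have hadj : Pᴴ = P := hP.isSelfAdjoint
  refine ⟨?_, ?_⟩
  · change (embed P.rank P)ᴴ = _
    simp [embed, hadj]
  · simp [embed, trace_eq_rank_of_isIdempotentElem hP.isIdempotentElem, hm']

lemma isOptimallySpread_of_finrank_lt_card {ι : Type*} [Fintype ι]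
    {P : ι → Matrix (Fin m) (Fin m) 𝕜} (hP : ∀ i, IsStarProjection (P i))
    (hrank : ∀ i, 0 < (P i).rank ∧ (P i).rank < m)
    (hcard : finrank ℝ (selfAdjoint.submodule ℝ (Matrix (Fin m) (Fin m) 𝕜)) < Fintype.card ι)
    (hgreatest : IsGreatest (pairInners fun i => embed (P i).rank (P i)) 0) :
    IsOptimallySpread P := by
  refine ⟨hrank, 0, hgreatest, ⟨_, fun i => ⟨P i, ⟨hP i, rfl⟩, rfl⟩, hgreatest⟩, ?_⟩
  rintro ν ⟨u, hu, hν⟩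
  by_contra! hneg
  obtain ⟨i⟩ : Nonempty ι := Fintype.card_pos_iff.1 (Nat.zero_lt_of_lt hcard)
  have hm : m ≠ 0 := (Nat.zero_lt_of_lt (hrank i).2).ne'
  have hu_mem (i) : u i ∈ tracelessSelfAdjoint 𝕜 m := by
    obtain ⟨Q, ⟨hQ, hQrank⟩, hQu⟩ := hu i
    rw [← hQu, ← hQrank]
    exact embed_mem_tracelessSelfAdjoint hm hQ
  have hu_neg : Pairwise fun i j => hsForm 𝕜 m (u i) (u j) < 0 := fun i j hij =>
    (hν.2 ⟨i, j, hij, rfl⟩).trans_lt hneg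
  have hcard_le := card_le_finrank_add_one_of_pairwise_neg posDef_hsForm hu_neg hu_mem
  have hdim := finrank_tracelessSelfAdjoint_lt (𝕜 := 𝕜) hm
  lia

lemma hsInner_embed {P Q : Matrix (Fin m) (Fin m) 𝕜} (hP : IsStarProjection P)
    (hQ : IsStarProjection Q) :
    hsInner (embed P.rank P) (embed Q.rank Q) = (radius m P.rank)⁻¹ * (radius m Q.rank)⁻¹ *
      (RCLike.re (P * Q).trace - P.rank * Q.rank / m) := by
  rcases eq_or_ne m 0 with rfl | hm
  · simp [hsInner, Matrix.trace]
  have hm' : (m : 𝕜) ≠ 0 := Nat.cast_ne_zero.2 hm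
  have hPadj : Pᴴ = P := hP.isSelfAdjoint
  have htrace : ((embed P.rank P)ᴴ * embed Q.rank Q).trace =
      (((radius m P.rank)⁻¹ * (radius m Q.rank)⁻¹ : ℝ) : 𝕜) *
        ((P * Q).trace - ((P.rank * Q.rank / m : ℝ) : 𝕜)) := by
    simp only [embed, conjTranspose_smul, conjTranspose_sub, hPadj, conjTranspose_one,
      smul_mul_assoc, mul_smul_comm, trace_smul, sub_mul, mul_sub, trace_sub, trace_one,
      trace_eq_rank_of_isIdempotentElem hP.isIdempotentElem,
      trace_eq_rank_of_isIdempotentElem hQ.isIdempotentElem,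
      Matrix.one_mul, Matrix.mul_one, smul_eq_mul, Fintype.card_fin, RCLike.star_def,
      RCLike.conj_ofReal, map_div₀, map_natCast]
    push_cast
    field_simp
    ring
  rw [hsInner, htrace, RCLike.re_ofReal_mul, map_sub, RCLike.ofReal_re]

end OptimallySpread

section CoordProj

variable {𝕜 : Type*} [RCLike 𝕜] {m : ℕ}
  (b b' : OrthonormalBasis (Fin m) 𝕜 (EuclideanSpace 𝕜 (Fin m))) (J K : Finset (Fin m))

lemma vecMulVec_star_mul_vecMulVec_star {n : Type*} [Fintype n] (x y : EuclideanSpace 𝕜 n) :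
    vecMulVec x (star x) * vecMulVec y (star y) = inner 𝕜 x y • vecMulVec x (star y) := by
  rw [vecMulVec_mul_vecMulVec, EuclideanSpace.inner_eq_star_dotProduct, dotProduct_comm,
    vecMulVec_smul]

lemma coordProj_eq_sum : coordProj b J = ∑ j ∈ J, vecMulVec (b j) (star (b j)) := rfl

lemma coordProj_mul : coordProj b J * coordProj b K = coordProj b (J ∩ K) := by
  simp only [coordProj_eq_sum, Finset.sum_mul_sum, vecMulVec_star_mul_vecMulVec_star,
    b.inner_eq_ite, ite_smul, one_smul, zero_smul, Finset.sum_ite_eq, ← Finset.sum_filter,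
    Finset.filter_mem_eq_inter]

lemma isStarProjection_coordProj : IsStarProjection (coordProj b J) where
  isIdempotentElem := by rw [IsIdempotentElem, coordProj_mul, Finset.inter_self]
  isSelfAdjoint := by
    change (coordProj b J)ᴴ = _
    simp only [coordProj_eq_sum, conjTranspose_sum, conjTranspose_vecMulVec, star_star]

lemma trace_coordProj_mul : (coordProj b J * coordProj b' K).trace =
    ((∑ j ∈ J, ∑ k ∈ K, ‖inner 𝕜 (b j) (b' k)‖ ^ 2 : ℝ) : 𝕜) := by
  have htrace (j k) : (vecMulVec (b j) (star (b' k))).trace = inner 𝕜 (b' k) (b j) := by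
    rw [trace_vecMulVec, EuclideanSpace.inner_eq_star_dotProduct]
  simp only [coordProj_eq_sum, Finset.sum_mul_sum, trace_sum, vecMulVec_star_mul_vecMulVec_star,
    trace_smul, htrace, smul_eq_mul, map_sum]
  refine Finset.sum_congr rfl fun j _ => Finset.sum_congr rfl fun k _ => ?_
  rw [← inner_conj_symm (b' k), RCLike.mul_conj, map_pow]

lemma trace_coordProj : (coordProj b J).trace = J.card := by
  rw [← (isStarProjection_coordProj b J).isIdempotentElem.eq, trace_coordProj_mul]
  simp [b.inner_eq_ite, apply_ite]

lemma rank_coordProj : (coordProj b J).rank = J.card :=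
  Nat.cast_injective (R := 𝕜) <| by
    rw [← trace_eq_rank_of_isIdempotentElem (isStarProjection_coordProj b J).isIdempotentElem,
      trace_coordProj]

lemma coordProj_univ : coordProj b Finset.univ = 1 := by
  rw [← (EuclideanSpace.basisFun (Fin m) 𝕜).toMatrix_orthonormalBasis_self_mul_conjTranspose b]
  ext i k
  simp [coordProj_eq_sum, Matrix.sum_apply, vecMulVec_apply, mul_apply, Basis.toMatrix_apply]

lemma sum_coordProj_of_card_filter_mem {S : Finset (Finset (Fin m))} {r : ℕ}
    (hr : ∀ x, (S.filter fun J => x ∈ J).card = r) :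
    ∑ J ∈ S, coordProj b J = r • (1 : Matrix (Fin m) (Fin m) 𝕜) := by
  rw [← coordProj_univ b]
  simp only [coordProj_eq_sum, Finset.smul_sum]
  rw [Finset.sum_comm' (t' := Finset.univ) (s' := fun j => S.filter fun J => j ∈ J) (by simp)]
  simp only [Finset.sum_const, hr]

variable {b b' J K}

lemma hsInner_embed_coordProj_nonpos (h : (J ∩ K).card * m ≤ J.card * K.card) :
    hsInner (embed (coordProj b J).rank (coordProj b J))
      (embed (coordProj b K).rank (coordProj b K)) ≤ 0 := by
  rcases J.eq_empty_or_nonempty with rfl | ⟨j, -⟩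
  · simp [coordProj_eq_sum, hsInner, embed]
  have hm : (0 : ℝ) < m := Nat.cast_pos.2 (Fin.pos j)
  rw [hsInner_embed (isStarProjection_coordProj b J) (isStarProjection_coordProj b K),
    coordProj_mul, trace_coordProj, rank_coordProj, rank_coordProj, RCLike.natCast_re]
  refine mul_nonpos_of_nonneg_of_nonpos
    (mul_nonneg (inv_nonneg.2 (Real.sqrt_nonneg _)) (inv_nonneg.2 (Real.sqrt_nonneg _))) ?_
  rw [sub_nonpos, le_div_iff₀ hm]
  exact_mod_cast h

lemma hsInner_embed_coordProj_of_unbiased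
    (h : ∀ j k, ‖inner 𝕜 (b j) (b' k)‖ ^ 2 = 1 / (m : ℝ)) :
    hsInner (embed (coordProj b J).rank (coordProj b J))
      (embed (coordProj b' K).rank (coordProj b' K)) = 0 := by
  rw [hsInner_embed (isStarProjection_coordProj b J) (isStarProjection_coordProj b' K),
    trace_coordProj_mul, RCLike.ofReal_re]
  simp only [h, Finset.sum_const, rank_coordProj, nsmul_eq_mul]
  ring

end CoordProj

section Design

lemma intCast_card_offDiag {α : Type*} (s : Finset α) :
    (s.offDiag.card : ℤ) = s.card * (s.card - 1) := by
  classical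
  rw [Finset.offDiag_card, Nat.cast_sub (Nat.le_mul_self _)]
  push_cast
  ring

lemma sum_card_inter_mul_sub_one {α : Type*} [DecidableEq α] {S : Finset (Finset α)} {lam : ℕ}
    (hlam : ∀ T : Finset α, T.card = 2 → (S.filter fun J => T ⊆ J).card = lam) (B : Finset α) :
    ∑ J ∈ S, ((B ∩ J).card : ℤ) * ((B ∩ J).card - 1) = B.card * (B.card - 1) * lam := by
  have hblocks (p) (hp : p ∈ B.offDiag) : (S.filter fun J => p.1 ∈ J ∧ p.2 ∈ J).card = lam := by
    simpa [Finset.insert_subset_iff] using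
      hlam {p.1, p.2} (Finset.card_pair (Finset.mem_offDiag.1 hp).2.2)
  have hpairs (J) : (B ∩ J).offDiag = B.offDiag.filter fun p => p.1 ∈ J ∧ p.2 ∈ J := by
    ext p
    simp only [Finset.mem_offDiag, Finset.mem_inter, Finset.mem_filter]
    tauto
  have hcount : ∑ J ∈ S, (B ∩ J).offDiag.card = B.offDiag.card * lam := by
    simp only [hpairs]
    rw [← smul_eq_mul, ← Finset.sum_const, ← Finset.sum_congr rfl hblocks]
    exact Finset.sum_card_bipartiteAbove_eq_sum_card_bipartiteBelow
      fun (J : Finset α) (p : α × α) => p.1 ∈ J ∧ p.2 ∈ J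
  simp only [← intCast_card_offDiag]
  exact_mod_cast hcount

variable {m l lam : ℕ} {S : Finset (Finset (Fin m))}

lemma card_filter_complDesign (p : Finset (Fin m) → Prop) [DecidablePred p] :
    ((complDesign S).filter p).card = (S.filter fun J => p Jᶜ).card := by
  rw [complDesign, Finset.filter_image, Finset.card_image_of_injective _ compl_injective]

namespace IsSymmetricDesign

lemma card_filter_mem (hS : IsSymmetricDesign l lam S) (x : Fin m) :
    (S.filter fun J => x ∈ J).card = l := by
  obtain ⟨⟨hl, -, r, hr⟩, hcard⟩ := hS
  have hcount := Finset.sum_card hr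
  rw [Finset.sum_congr rfl hl, Finset.sum_const, hcard, Fintype.card_fin, smul_eq_mul] at hcount
  rw [hr, Nat.eq_of_mul_eq_mul_left (Fin.pos x) hcount]

lemma pos (hS : IsSymmetricDesign l lam S) (hm : 2 ≤ m) : 0 < l := by
  by_contra! hl
  have hsub : S ⊆ {∅} := fun J hJ => by
    rw [Finset.mem_singleton, ← Finset.card_eq_zero, hS.1.1 J hJ]
    lia
  have hcard := Finset.card_le_card hsub
  rw [hS.2, Finset.card_singleton] at hcard
  lia

lemma nonempty_of_mem (hS : IsSymmetricDesign l lam S) (hm : 2 ≤ m) (J : Finset (Fin m))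
    (hJ : J ∈ S) : J.Nonempty := by
  rw [← Finset.card_pos, hS.1.1 J hJ]
  exact hS.pos hm

lemma ne_zero_of_mem (hS : IsSymmetricDesign l lam S) {J : Finset (Fin m)} (hJ : J ∈ S) : m ≠ 0 :=
  hS.2 ▸ Finset.card_ne_zero_of_mem hJ

lemma mul_sub_one_eq (hS : IsSymmetricDesign l lam S) (hm : m ≠ 0) :
    (l : ℤ) * (l - 1) = lam * (m - 1) := by
  have hcount := sum_card_inter_mul_sub_one hS.1.2.1 Finset.univ
  rw [Finset.sum_congr rfl fun J hJ => by rw [Finset.univ_inter, hS.1.1 J hJ], Finset.sum_const,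
    hS.2, Finset.card_fin, nsmul_eq_mul] at hcount
  refine mul_left_cancel₀ (Nat.cast_ne_zero.2 hm) (hcount.trans ?_)
  ring

lemma complDesign (hS : IsSymmetricDesign l lam S) :
    IsSymmetricDesign (m - l) (m + lam - 2 * l) (complDesign S) := by
  refine ⟨⟨?_, fun T hT => ?_, m - l, fun x => ?_⟩, ?_⟩
  · simp only [MixedPacking.complDesign, Finset.forall_mem_image]
    intro J hJ
    rw [Finset.card_compl, Fintype.card_fin, hS.1.1 J hJ]
  · obtain ⟨x, y, -, rfl⟩ := Finset.card_eq_two.1 hT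
    have hpair : (S.filter fun J => x ∈ J ∧ y ∈ J).card = lam := by
      simpa [Finset.insert_subset_iff] using hS.1.2.1 {x, y} hT
    have hor := Finset.card_union_add_card_inter (S.filter fun J => x ∈ J) (S.filter fun J => y ∈ J)
    have hnor := Finset.card_filter_add_card_filter_not (s := S) fun J => x ∈ J ∨ y ∈ J
    rw [← Finset.filter_or, ← Finset.filter_and, hpair, hS.card_filter_mem, hS.card_filter_mem]
      at hor
    simp only [hS.2, not_or] at hnor
    simp only [card_filter_complDesign, Finset.insert_subset_iff, Finset.singleton_subset_iff,
      Finset.mem_compl]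
    lia
  · have hmem := Finset.card_filter_add_card_filter_not (s := S) fun J => x ∈ J
    rw [hS.card_filter_mem, hS.2] at hmem
    simp only [card_filter_complDesign, Finset.mem_compl]
    lia
  · rw [MixedPacking.complDesign, Finset.card_image_of_injective _ compl_injective, hS.2]

lemma lt (hS : IsSymmetricDesign l lam S) (hm : 2 ≤ m) : l < m :=
  Nat.lt_of_sub_pos (hS.complDesign.pos hm)

lemma ne_sub_self (hS : IsSymmetricDesign l lam S) (hm : 2 < m) : l ≠ m - l := by
  intro hl
  obtain rfl : m = 2 * l := by have := hS.lt hm.le; lia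
  have hdvd : (2 * (l : ℤ) - 1) ∣ 1 := by
    refine ⟨2 * l - 1 - 4 * lam, ?_⟩
    have := hS.mul_sub_one_eq (by lia)
    push_cast at this
    linear_combination -4 * this
  have := Int.le_of_dvd one_pos hdvd
  lia

lemma card_inter (hS : IsSymmetricDesign l lam S) {J K : Finset (Fin m)} (hJ : J ∈ S)
    (hK : K ∈ S) (hJK : J ≠ K) : (J ∩ K).card = lam := by
  have hsum : ∑ K ∈ S, ((J ∩ K).card : ℤ) = l * l := by
    have := Finset.sum_card_inter fun x (_ : x ∈ J) => hS.card_filter_mem x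
    rw [hS.1.1 J hJ] at this
    exact_mod_cast this
  have hsum_pairs : ∑ K ∈ S, ((J ∩ K).card : ℤ) * ((J ∩ K).card - 1) = l * (l - 1) * lam := by
    rw [sum_card_inter_mul_sub_one hS.1.2.1, hS.1.1 J hJ]
  have hvariance : ∑ K ∈ S, (((J ∩ K).card : ℤ) - lam) ^ 2 = (l - lam) ^ 2 := by
    have hexpand (K : Finset (Fin m)) : (((J ∩ K).card : ℤ) - lam) ^ 2 =
      (J ∩ K).card * ((J ∩ K).card - 1) + (1 - 2 * lam) * (J ∩ K).card + lam ^ 2 := by ring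
    simp only [hexpand, Finset.sum_add_distrib, ← Finset.mul_sum, hsum, hsum_pairs,
      Finset.sum_const, hS.2, nsmul_eq_mul]
    linear_combination (-(lam : ℤ)) * hS.mul_sub_one_eq (hS.ne_zero_of_mem hJ)
  rw [← Finset.add_sum_erase _ _ hJ, Finset.inter_self, hS.1.1 J hJ, add_eq_left,
    Finset.sum_eq_zero_iff_of_nonneg fun K _ => sq_nonneg _] at hvariance
  have := pow_eq_zero_iff two_ne_zero |>.1 (hvariance K (Finset.mem_erase.2 ⟨hJK.symm, hK⟩))
  lia

lemma card_inter_mul_le (hS : IsSymmetricDesign l lam S) {J K : Finset (Fin m)} (hJ : J ∈ S)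
    (hK : K ∈ S) (hJK : J ≠ K) : (J ∩ K).card * m ≤ J.card * K.card := by
  have hle : lam ≤ l := by
    rw [← hS.card_inter hJ hK hJK, ← hS.1.1 J hJ]
    exact Finset.card_le_card Finset.inter_subset_left
  rw [hS.card_inter hJ hK hJK, hS.1.1 J hJ, hS.1.1 K hK]
  have := hS.mul_sub_one_eq (hS.ne_zero_of_mem hJ)
  zify at hle ⊢
  linarith

end IsSymmetricDesign

end Design

section Packing

variable {𝕜 : Type*} [RCLike 𝕜] {m : ℕ} {κ : Type*}
  {B : κ → OrthonormalBasis (Fin m) 𝕜 (EuclideanSpace 𝕜 (Fin m))}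

lemma isOptimallySpread_coordProj {ι : Type*} [Fintype ι] (hB : IsMUB B) {k : ι → κ}
    {J : ι → Finset (Fin m)} (hJ : ∀ i, 0 < (J i).card ∧ (J i).card < m)
    (hinter : ∀ i j, i ≠ j → k i = k j → (J i ∩ J j).card * m ≤ (J i).card * (J j).card)
    (hk : ∃ i j, k i ≠ k j)
    (hcard : finrank ℝ (selfAdjoint.submodule ℝ (Matrix (Fin m) (Fin m) 𝕜)) < Fintype.card ι) :
    IsOptimallySpread fun i => coordProj (B (k i)) (J i) := by
  refine isOptimallySpread_of_finrank_lt_card (fun i => isStarProjection_coordProj _ _)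
    (fun i => by simpa only [rank_coordProj] using hJ i) hcard ⟨?_, ?_⟩
  · obtain ⟨i, j, hij⟩ := hk
    exact ⟨i, j, ne_of_apply_ne k hij, hsInner_embed_coordProj_of_unbiased (hB _ _ hij)⟩
  · rintro _ ⟨i, j, hij, rfl⟩
    by_cases hkij : k i = k j
    · simp only [hkij]
      exact hsInner_embed_coordProj_nonpos (hinter i j hij hkij)
    · exact (hsInner_embed_coordProj_of_unbiased (hB _ _ hkij)).le

variable {A₁ A₂ : Finset κ} {S₁ S₂ : Finset (Finset (Fin m))} {l₁ l₂ lam₁ lam₂ : ℕ}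

lemma unionFamily_eq_coordProj : unionFamily B A₁ A₂ S₁ S₂ = fun i =>
    coordProj (B (Sum.elim (fun p => p.1.1) (fun p => p.1.1) i))
      (Sum.elim (fun p => p.2.1) (fun p => p.2.1) i) := by
  ext (i | i) : 1 <;> rfl

lemma isPacking_unionFamily (h₁ : ∀ J ∈ S₁, J.Nonempty) (h₂ : ∀ J ∈ S₂, J.Nonempty) :
    IsPacking (unionFamily B A₁ A₂ S₁ S₂) := by
  have hcoord {k : κ} {J : Finset (Fin m)} (hJ : J.Nonempty) :
      IsStarProjection (coordProj (B k) J) ∧ 1 ≤ (coordProj (B k) J).rank ∧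
        (coordProj (B k) J).rank ≤ m := by
    rw [rank_coordProj]
    exact ⟨isStarProjection_coordProj _ _, hJ.card_pos, by simpa using J.card_le_univ⟩
  rintro (⟨k, J⟩ | ⟨k, J⟩)
  exacts [hcoord (h₁ J J.2), hcoord (h₂ J J.2)]

lemma sum_unionFamily (hS₁ : IsSymmetricDesign l₁ lam₁ S₁) (hS₂ : IsSymmetricDesign l₂ lam₂ S₂) :
    ∑ i, unionFamily B A₁ A₂ S₁ S₂ i =
      (A₁.card * l₁ + A₂.card * l₂) • (1 : Matrix (Fin m) (Fin m) 𝕜) := by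
  have hsum {l lam : ℕ} {S : Finset (Finset (Fin m))} (hS : IsSymmetricDesign l lam S) (k : κ) :
      ∑ J : S, coordProj (B k) J = l • (1 : Matrix (Fin m) (Fin m) 𝕜) := by
    rw [Finset.sum_coe_sort S (coordProj (B k)),
      sum_coordProj_of_card_filter_mem _ hS.card_filter_mem]
  simp only [unionFamily, Fintype.sum_sum_type, Fintype.sum_prod_type, Sum.elim_inl, Sum.elim_inr,
    hsum hS₁, hsum hS₂, Finset.sum_const, Finset.card_univ, Fintype.card_coe, smul_smul, add_smul]

lemma isTightFusionFrame_unionFamily (hS₁ : IsSymmetricDesign l₁ lam₁ S₁)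
    (hS₂ : IsSymmetricDesign l₂ lam₂ S₂) (hm : 2 ≤ m) (hA₁ : A₁.Nonempty) :
    IsTightFusionFrame (unionFamily B A₁ A₂ S₁ S₂) := by
  have hpos : 0 < A₁.card * l₁ + A₂.card * l₂ :=
    Nat.add_pos_left (Nat.mul_pos hA₁.card_pos (hS₁.pos hm)) _
  rw [IsTightFusionFrame, sum_unionFamily hS₁ hS₂, ← Nat.cast_smul_eq_nsmul 𝕜]
  exact ⟨PosDef.one.smul (Nat.cast_pos.2 hpos), _, rfl⟩

lemma rank_unionFamily_inl (hS₁ : IsSymmetricDesign l₁ lam₁ S₁) (i : A₁ × S₁) :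
    (unionFamily B A₁ A₂ S₁ S₂ (Sum.inl i)).rank = l₁ :=
  (rank_coordProj _ _).trans (hS₁.1.1 _ i.2.2)

lemma rank_unionFamily_inr (hS₂ : IsSymmetricDesign l₂ lam₂ S₂) (i : A₂ × S₂) :
    (unionFamily B A₁ A₂ S₁ S₂ (Sum.inr i)).rank = l₂ :=
  (rank_coordProj _ _).trans (hS₂.1.1 _ i.2.2)

lemma mixture_unionFamily (hS₁ : IsSymmetricDesign l₁ lam₁ S₁)
    (hS₂ : IsSymmetricDesign l₂ lam₂ S₂) (hl : l₁ ≠ l₂) [Nonempty (A₁ × S₁)]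
    [Nonempty (A₂ × S₂)] : mixture (unionFamily B A₁ A₂ S₁ S₂) = 2 := by
  rw [← Finset.card_pair hl, mixture]
  congr 1
  ext r
  simp [rank_unionFamily_inl hS₁, rank_unionFamily_inr hS₂, eq_comm]

lemma nonempty_prod_coe (hS₁ : IsSymmetricDesign l₁ lam₁ S₁) (hm : m ≠ 0) (hA₁ : A₁.Nonempty) :
    Nonempty (A₁ × S₁) := by
  have hS : S₁.Nonempty := by rwa [← Finset.card_ne_zero, hS₁.2]
  have := hA₁.coe_sort
  have := hS.coe_sort
  infer_instance

lemma isOptimallySpread_unionFamily [Fintype κ] [DecidableEq κ]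
    (hcard : finrank ℝ (selfAdjoint.submodule ℝ (Matrix (Fin m) (Fin m) 𝕜)) < Fintype.card κ * m)
    (hm : 2 ≤ m) (hS₁ : IsSymmetricDesign l₁ lam₁ S₁) (hS₂ : IsSymmetricDesign l₂ lam₂ S₂)
    (hB : IsMUB B) (hA : IsTwoPartition A₁ A₂) :
    IsOptimallySpread (unionFamily B A₁ A₂ S₁ S₂) := by
  obtain ⟨hA₁, hA₂, hdisj, hunion⟩ := hA
  obtain ⟨i₁⟩ := nonempty_prod_coe hS₁ (by lia) hA₁
  obtain ⟨i₂⟩ := nonempty_prod_coe hS₂ (by lia) hA₂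
  have hne (k : A₁) (k' : A₂) : k.1 ≠ k'.1 := Finset.disjoint_iff_ne.1 hdisj _ k.2 _ k'.2
  rw [unionFamily_eq_coordProj]
  refine isOptimallySpread_coordProj hB ?_ ?_ ⟨Sum.inl i₁, Sum.inr i₂, hne _ _⟩ ?_
  · rintro (⟨k, J⟩ | ⟨k, J⟩)
    · simpa only [Sum.elim_inl, hS₁.1.1 _ J.2] using ⟨hS₁.pos hm, hS₁.lt hm⟩
    · simpa only [Sum.elim_inr, hS₂.1.1 _ J.2] using ⟨hS₂.pos hm, hS₂.lt hm⟩
  · rintro (⟨k, J⟩ | ⟨k, J⟩) (⟨k', K⟩ | ⟨k', K⟩) hij hk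
    · obtain rfl : k = k' := Subtype.ext hk
      exact hS₁.card_inter_mul_le J.2 K.2 fun hJK =>
        hij (congrArg (fun L => Sum.inl (k, L)) (Subtype.ext hJK))
    · exact absurd hk (hne k k')
    · exact absurd hk.symm (hne k' k)
    · obtain rfl : k = k' := Subtype.ext hk
      exact hS₂.card_inter_mul_le J.2 K.2 fun hJK =>
        hij (congrArg (fun L => Sum.inr (k, L)) (Subtype.ext hJK))
  · rwa [Fintype.card_sum, Fintype.card_prod, Fintype.card_prod, Fintype.card_coe,
      Fintype.card_coe, Fintype.card_coe, Fintype.card_coe, hS₁.2, hS₂.2, ← add_mul,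
      ← Finset.card_union_of_disjoint hdisj, hunion, Finset.card_univ]

theorem isTightOptimalMixedPacking_unionFamily [Fintype κ] [DecidableEq κ]
    (hcard : finrank ℝ (selfAdjoint.submodule ℝ (Matrix (Fin m) (Fin m) 𝕜)) < Fintype.card κ * m)
    (hm : 2 ≤ m) (hS₁ : IsSymmetricDesign l₁ lam₁ S₁) (hS₂ : IsSymmetricDesign l₂ lam₂ S₂)
    (hl : l₁ ≠ l₂) (hB : IsMUB B) (hA : IsTwoPartition A₁ A₂) :
    IsTightOptimalMixedPacking (unionFamily B A₁ A₂ S₁ S₂) 2 := by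
  have := nonempty_prod_coe hS₁ (by lia) hA.1
  have := nonempty_prod_coe hS₂ (by lia) hA.2.1
  exact ⟨isPacking_unionFamily (hS₁.nonempty_of_mem hm) (hS₂.nonempty_of_mem hm),
    isTightFusionFrame_unionFamily hS₁ hS₂ hm hA.1,
    isOptimallySpread_unionFamily hcard hm hS₁ hS₂ hB hA, mixture_unionFamily hS₁ hS₂ hl,
    by norm_num⟩

theorem isTightOptimalMixedPacking_unionFamily_real [Fintype κ] [DecidableEq κ]
    (hκ : m + 1 < 2 * Fintype.card κ) (hm : 2 ≤ m) (hS₁ : IsSymmetricDesign l₁ lam₁ S₁)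
    (hS₂ : IsSymmetricDesign l₂ lam₂ S₂) (hl : l₁ ≠ l₂)
    {B : κ → OrthonormalBasis (Fin m) ℝ (EuclideanSpace ℝ (Fin m))} (hB : IsMUB B)
    (hA : IsTwoPartition A₁ A₂) :
    IsTightOptimalMixedPacking (unionFamily B A₁ A₂ S₁ S₂) 2 := by
  refine isTightOptimalMixedPacking_unionFamily ?_ hm hS₁ hS₂ hl hB hA
  refine (finrank_selfAdjoint_matrix_real_le (Fin m)).trans_lt ?_
  rw [Fintype.card_fin, Nat.choose_two_right, Nat.add_sub_cancel]
  refine Nat.div_lt_of_lt_mul ?_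
  nlinarith

theorem isTightOptimalMixedPacking_unionFamily_of_lt_card [Fintype κ] [DecidableEq κ]
    (hκ : m < Fintype.card κ) (hm : 2 ≤ m) (hS₁ : IsSymmetricDesign l₁ lam₁ S₁)
    (hS₂ : IsSymmetricDesign l₂ lam₂ S₂) (hl : l₁ ≠ l₂) (hB : IsMUB B)
    (hA : IsTwoPartition A₁ A₂) :
    IsTightOptimalMixedPacking (unionFamily B A₁ A₂ S₁ S₂) 2 := by
  refine isTightOptimalMixedPacking_unionFamily ?_ hm hS₁ hS₂ hl hB hA
  refine (finrank_selfAdjoint_matrix_le (Fin m) 𝕜).trans_lt ?_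
  rw [Fintype.card_fin]
  nlinarith

end Packing

section QuadraticRefinement

variable {𝕜 k V : Type*} [RCLike 𝕜] [Field k] [AddCommGroup V] [Module k V]
  {e : AddChar k 𝕜} {β β' : LinearMap.BilinForm k V} {χ χ' : V → 𝕜}

/-- The multiplicative analogue of a quadratic form with polar form `β`: `χ` has values of
norm one and fails to be a character of `V` by the factor `e (β x y)`. Unlike quadratic forms,
these functions exist for all symmetric `β` over `ZMod 2` if `𝕜 = ℂ`. -/
structure IsQuadraticRefinement (e : AddChar k 𝕜) (β : LinearMap.BilinForm k V)
    (χ : V → 𝕜) : Prop where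
  norm_eq_one : ∀ x, ‖χ x‖ = 1
  map_add_eq_mul : ∀ x y, χ (x + y) = χ x * χ y * e (β x y)

namespace IsQuadraticRefinement

lemma mul (hχ : IsQuadraticRefinement e β χ) (hχ' : IsQuadraticRefinement e β' χ') :
    IsQuadraticRefinement e (β + β') fun x => χ x * χ' x where
  norm_eq_one x := by rw [norm_mul, hχ.norm_eq_one, hχ'.norm_eq_one, one_mul]
  map_add_eq_mul x y := by
    simp only [hχ.map_add_eq_mul, hχ'.map_add_eq_mul, LinearMap.add_apply,
      AddChar.map_add_eq_mul]
    ring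

variable [Finite k]

lemma conj_mul (hχ : IsQuadraticRefinement e β χ) (hχ' : IsQuadraticRefinement e β' χ') :
    IsQuadraticRefinement e (β' - β) fun x => (starRingEnd 𝕜) (χ x) * χ' x where
  norm_eq_one x := by rw [norm_mul, RCLike.norm_conj, hχ.norm_eq_one, hχ'.norm_eq_one, one_mul]
  map_add_eq_mul x y := by
    rw [hχ.map_add_eq_mul, hχ'.map_add_eq_mul, LinearMap.sub_apply, LinearMap.sub_apply,
      sub_eq_add_neg, e.map_add_eq_mul, e.map_neg_eq_conj, map_mul, map_mul]
    ring

lemma mul_addChar (hχ : IsQuadraticRefinement e β χ) (φ : Dual k V) :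
    IsQuadraticRefinement e β fun x => χ x * e (φ x) where
  norm_eq_one x := by rw [norm_mul, hχ.norm_eq_one, e.norm_apply, one_mul]
  map_add_eq_mul x y := by
    rw [hχ.map_add_eq_mul, map_add, e.map_add_eq_mul]
    ring

lemma of_eq_add_swap {C : LinearMap.BilinForm k V} (hC : ∀ x y, β x y = C x y + C y x) :
    IsQuadraticRefinement e β fun x => e (C x x) where
  norm_eq_one x := e.norm_apply _
  map_add_eq_mul x y := by
    simp only [hC, map_add, LinearMap.add_apply, AddChar.map_add_eq_mul]
    ring

end IsQuadraticRefinement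

lemma exists_isQuadraticRefinement_of_isSymm [Finite k] (e : AddChar k 𝕜) (hβ : β.IsSymm)
    (hk : (2 : k) ≠ 0) : ∃ χ, IsQuadraticRefinement e β χ := by
  refine ⟨_, .of_eq_add_swap (C := (2⁻¹ : k) • β) fun x y => ?_⟩
  have hsymm : β x y = β y x := hβ.eq x y
  rw [LinearMap.smul_apply, LinearMap.smul_apply, LinearMap.smul_apply, LinearMap.smul_apply,
    hsymm, ← two_mul, smul_eq_mul, mul_inv_cancel_left₀ hk]

lemma exists_eq_sub_swap_of_isAlt [FiniteDimensional k V] (hβ : β.IsAlt) :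
    ∃ C : LinearMap.BilinForm k V, ∀ x y, β x y = C x y - C y x := by
  let b := finBasis k V
  let C := Matrix.toBilin b (.of fun i j => if i < j then β (b i) (b j) else 0)
  have hC (i j) : C (b i) (b j) = if i < j then β (b i) (b j) else 0 := by
    rw [← LinearMap.BilinForm.toMatrix_apply, LinearMap.BilinForm.toMatrix_toBilin, of_apply]
  suffices h : β = C - LinearMap.flip C from ⟨C, fun x y => LinearMap.congr_fun₂ h x y⟩
  refine LinearMap.BilinForm.ext_basis b fun i j => ?_
  rw [LinearMap.sub_apply, LinearMap.sub_apply, LinearMap.flip_apply, hC, hC]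
  rcases lt_trichotomy i j with hij | rfl | hij
  · simp [hij, hij.not_gt]
  · simp [hβ.self_eq_zero]
  · simp [hij, hij.not_gt, hβ.neg_eq]

lemma exists_isQuadraticRefinement_of_isAlt [Finite k] [CharP k 2] [FiniteDimensional k V]
    (e : AddChar k 𝕜) (hβ : β.IsAlt) : ∃ χ, IsQuadraticRefinement e β χ := by
  obtain ⟨C, hC⟩ := exists_eq_sub_swap_of_isAlt hβ
  exact ⟨_, .of_eq_add_swap fun x y => (hC x y).trans (CharTwo.sub_eq_add _ _)⟩

end QuadraticRefinement

section CharTwo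

variable {V : Type*} [AddCommGroup V] [Module (ZMod 2) V]

/-- The diagonal of a symmetric bilinear form over `ZMod 2`, which is linear since squaring is. -/
def diagonalDual (β : LinearMap.BilinForm (ZMod 2) V) (hβ : β.IsSymm) : Dual (ZMod 2) V :=
  AddMonoidHom.toZModLinearMap 2 <| AddMonoidHom.mk' (fun x => β x x) fun x y => by
    simp only [map_add, LinearMap.add_apply, hβ.eq y x]
    linear_combination CharTwo.add_self_eq_zero (β x y)

lemma exists_isQuadraticRefinement_linMulLin (e : AddChar (ZMod 2) ℂ) (φ : Dual (ZMod 2) V) :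
    ∃ χ, IsQuadraticRefinement e (LinearMap.BilinForm.linMulLin φ φ) χ := by
  obtain ⟨z, hz⟩ := IsAlgClosed.exists_eq_mul_self (e 1)
  have hz1 : ‖z‖ = 1 := by
    rw [← pow_eq_one_iff_of_nonneg (norm_nonneg z) two_ne_zero, sq, ← norm_mul, ← hz,
      e.norm_apply]
  have hz4 : z * z * e 1 = 1 := by
    rw [← hz, ← e.map_add_eq_mul, CharTwo.add_self_eq_zero, e.map_zero_eq_one]
  have hcases : ∀ c : ZMod 2, c = 0 ∨ c = 1 := by decide
  refine ⟨fun x => if φ x = 1 then z else 1, fun x => ?_, fun x y => ?_⟩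
  · split_ifs
    exacts [hz1, norm_one]
  · rw [LinearMap.BilinForm.linMulLin_apply, map_add]
    rcases hcases (φ x) with hx | hx <;> rcases hcases (φ y) with hy | hy <;>
      simp [hx, hy, hz4, CharTwo.add_self_eq_zero]

lemma exists_isQuadraticRefinement_zmod_two [FiniteDimensional (ZMod 2) V]
    (e : AddChar (ZMod 2) ℂ) {β : LinearMap.BilinForm (ZMod 2) V} (hβ : β.IsSymm) :
    ∃ χ, IsQuadraticRefinement e β χ := by
  let L := LinearMap.BilinForm.linMulLin (diagonalDual β hβ) (diagonalDual β hβ)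
  have halt : (β - L).IsAlt := fun x => by
    have hsq : ∀ c : ZMod 2, c - c * c = 0 := by decide
    exact hsq (β x x)
  obtain ⟨χ, hχ⟩ := exists_isQuadraticRefinement_of_isAlt e halt
  obtain ⟨χ', hχ'⟩ := exists_isQuadraticRefinement_linMulLin e (diagonalDual β hβ)
  exact ⟨_, sub_add_cancel β L ▸ hχ.mul hχ'⟩

end CharTwo

section GaussSum

variable {𝕜 k V : Type*} [RCLike 𝕜] [Field k] [AddCommGroup V] [Module k V] [Fintype V]
  {e : AddChar k 𝕜} {β : LinearMap.BilinForm k V} {χ : V → 𝕜}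

lemma sum_addChar_dual_eq_zero (he : e ≠ 1) {φ : Dual k V} (hφ : φ ≠ 0) :
    ∑ x, e (φ x) = 0 := by
  obtain ⟨c, hc⟩ := AddChar.ne_one_iff.1 he
  obtain ⟨x, rfl⟩ := LinearMap.surjective hφ c
  have hne : e.compAddMonoidHom φ.toAddMonoidHom ≠ 0 := AddChar.ne_zero_iff.2 ⟨x, hc⟩
  simpa using AddChar.sum_eq_zero_iff_ne_zero.2 hne

lemma conj_mul_self_of_norm_eq_one {z : 𝕜} (hz : ‖z‖ = 1) : (starRingEnd 𝕜) z * z = 1 := by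
  rw [RCLike.conj_mul, hz, RCLike.ofReal_one, one_pow]

lemma IsQuadraticRefinement.norm_sum_sq (hχ : IsQuadraticRefinement e β χ) (he : e ≠ 1)
    (hβ : β.SeparatingRight) : ‖∑ x, χ x‖ ^ 2 = Fintype.card V := by
  have hshift (x h : V) : (starRingEnd 𝕜) (χ x) * χ (x + h) = χ h * e (β x h) := by
    rw [hχ.map_add_eq_mul, ← mul_assoc, ← mul_assoc,
      conj_mul_self_of_norm_eq_one (hχ.norm_eq_one x), one_mul]
  have hzero : χ 0 = 1 := by
    have hself := conj_mul_self_of_norm_eq_one (hχ.norm_eq_one 0)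
    have hadd := hshift 0 0
    rw [add_zero, hself, map_zero, e.map_zero_eq_one, mul_one] at hadd
    exact hadd.symm
  suffices h : ((‖∑ x, χ x‖ ^ 2 : ℝ) : 𝕜) = Fintype.card V by exact_mod_cast h
  calc ((‖∑ x, χ x‖ ^ 2 : ℝ) : 𝕜)
      = ∑ x, ∑ y, (starRingEnd 𝕜) (χ x) * χ y := by
        rw [RCLike.ofReal_pow, ← RCLike.conj_mul, map_sum, Finset.sum_mul_sum]
    _ = ∑ x, ∑ h, χ h * e (β x h) := by
        refine Finset.sum_congr rfl fun x _ => ?_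
        simp only [← hshift]
        exact (Equiv.sum_comp (Equiv.addLeft x) fun y => (starRingEnd 𝕜) (χ x) * χ y).symm
    _ = ∑ h, χ h * ∑ x, e (β x h) := by
        rw [Finset.sum_comm]
        simp only [Finset.mul_sum]
    _ = χ 0 * ∑ x, e (β x 0) := by
        refine Fintype.sum_eq_single 0 fun h hh => ?_
        have hne : LinearMap.flip β h ≠ 0 := fun h0 =>
          hh (hβ h fun x => LinearMap.congr_fun h0 x)
        rw [← mul_zero (χ h), ← sum_addChar_dual_eq_zero he hne]
        rfl
    _ = Fintype.card V := by simp [hzero]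

end GaussSum

section UnbiasedBases

variable {𝕜 V : Type*} [RCLike 𝕜] [Fintype V] {χ χ' : V → 𝕜}

/-- The vector with the entries `χ x / √|V|`, a unit vector if `χ` has values of norm one. -/
def normalizedVector (χ : V → 𝕜) : EuclideanSpace 𝕜 V :=
  (((√(Fintype.card V))⁻¹ : ℝ) : 𝕜) • WithLp.toLp 2 χ

lemma inner_normalizedVector (χ χ' : V → 𝕜) :
    inner 𝕜 (normalizedVector χ) (normalizedVector χ') =
      (Fintype.card V : 𝕜)⁻¹ * ∑ x, (starRingEnd 𝕜) (χ x) * χ' x := by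
  have hsqrt : ((√(Fintype.card V) : ℝ) : 𝕜) * (√(Fintype.card V) : ℝ) = Fintype.card V := by
    exact_mod_cast Real.mul_self_sqrt (Nat.cast_nonneg (Fintype.card V))
  rw [normalizedVector, normalizedVector, inner_smul_left, inner_smul_right, RCLike.conj_ofReal,
    ← mul_assoc, RCLike.ofReal_inv, ← mul_inv, hsqrt, PiLp.inner_apply]
  simp only [RCLike.inner_apply, mul_comm]

lemma norm_inner_basisFun_normalizedVector_sq (hχ : ∀ x, ‖χ x‖ = 1) (x : V) :
    ‖inner 𝕜 (EuclideanSpace.basisFun V 𝕜 x) (normalizedVector χ)‖ ^ 2 =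
      1 / (Fintype.card V : ℝ) := by
  classical
  rw [EuclideanSpace.basisFun_apply, EuclideanSpace.inner_single_left, map_one, one_mul,
    normalizedVector, PiLp.smul_apply, smul_eq_mul, norm_mul, hχ, mul_one, RCLike.norm_ofReal,
    sq_abs, inv_pow, Real.sq_sqrt (Nat.cast_nonneg _), one_div]

variable {k : Type*} [Field k] [AddCommGroup V] [Module k V] {e : AddChar k 𝕜}
  {β β' : LinearMap.BilinForm k V}

lemma norm_inner_normalizedVector_sq [Finite k] (he : e ≠ 1)
    (hχ : IsQuadraticRefinement e β χ) (hχ' : IsQuadraticRefinement e β' χ')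
    (hβ : (β' - β).SeparatingRight) :
    ‖inner 𝕜 (normalizedVector χ) (normalizedVector χ')‖ ^ 2 = 1 / (Fintype.card V : ℝ) := by
  rw [inner_normalizedVector, norm_mul, mul_pow, (hχ.conj_mul hχ').norm_sum_sq he hβ, norm_inv,
    RCLike.norm_natCast]
  field_simp

lemma orthonormal_normalizedVector [Finite k] (he : e ≠ 1) (hχ : ∀ x, ‖χ x‖ = 1) :
    Orthonormal 𝕜 fun φ : Dual k V => normalizedVector fun x => χ x * e (φ x) := by
  classical
  refine orthonormal_iff_ite.2 fun φ ψ => ?_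
  have hterm (x : V) : (starRingEnd 𝕜) (χ x * e (φ x)) * (χ x * e (ψ x)) = e ((ψ - φ) x) := by
    rw [LinearMap.sub_apply, sub_eq_add_neg, e.map_add_eq_mul, e.map_neg_eq_conj, map_mul]
    linear_combination (starRingEnd 𝕜) (e (φ x)) * e (ψ x) * conj_mul_self_of_norm_eq_one (hχ x)
  simp only [inner_normalizedVector, hterm]
  split_ifs with hφ
  · simp [hφ]
  · rw [sum_addChar_dual_eq_zero he (sub_ne_zero.2 (Ne.symm hφ)), mul_zero]

lemma exists_orthonormalBasis_normalizedVector [Finite k] (he : e ≠ 1) (hχ : ∀ x, ‖χ x‖ = 1) :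
    ∃ b : OrthonormalBasis V 𝕜 (EuclideanSpace 𝕜 V),
      ∀ y, ∃ φ : Dual k V, b y = normalizedVector fun x => χ x * e (φ x) := by
  obtain ⟨D⟩ : Nonempty (V ≃ₗ[k] Dual k V) := ⟨(finBasis k V).toDualEquiv⟩
  let v : V → EuclideanSpace 𝕜 V := fun y => normalizedVector fun x => χ x * e (D y x)
  have hv : Orthonormal 𝕜 v := (orthonormal_normalizedVector he hχ).comp D D.injective
  obtain ⟨b, hb⟩ := Orthonormal.exists_orthonormalBasis_extension_of_card_eq
    finrank_euclideanSpace (v := v) (s := Set.univ) (hv.comp _ Subtype.val_injective)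
  exact ⟨b, fun y => ⟨D y, hb y (Set.mem_univ y)⟩⟩

lemma exists_isMUB_of_orthonormalBasis {m : ℕ} {X κ : Type*} [Fintype X]
    (hm : Fintype.card X = m) {B : κ → OrthonormalBasis X 𝕜 (EuclideanSpace 𝕜 X)}
    (hB : ∀ s t, s ≠ t → ∀ x y, ‖inner 𝕜 (B s x) (B t y)‖ ^ 2 = 1 / (Fintype.card X : ℝ)) :
    ∃ B : κ → OrthonormalBasis (Fin m) 𝕜 (EuclideanSpace 𝕜 (Fin m)), IsMUB B := by
  let σ : X ≃ Fin m := Fintype.equivFinOfCardEq hm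
  refine ⟨fun s => ((B s).reindex σ).map (LinearIsometryEquiv.piLpCongrLeft 2 𝕜 𝕜 σ),
    fun s t hst i j => ?_⟩
  rw [OrthonormalBasis.map_apply, OrthonormalBasis.map_apply, LinearIsometryEquiv.inner_map_map,
    OrthonormalBasis.reindex_apply, OrthonormalBasis.reindex_apply, hB s t hst, hm]

theorem exists_isMUB_of_isQuadraticRefinement [Finite k] {m : ℕ} (hm : Fintype.card V = m)
    (he : e ≠ 1) {K : Type*} {β : K → LinearMap.BilinForm k V}
    (hβ : ∀ s t, s ≠ t → (β s - β t).SeparatingRight)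
    (hχ : ∀ s, ∃ χ, IsQuadraticRefinement e (β s) χ) :
    ∃ B : Option K → OrthonormalBasis (Fin m) 𝕜 (EuclideanSpace 𝕜 (Fin m)), IsMUB B := by
  choose χ hχ using hχ
  choose b φ hb using fun s =>
    exists_orthonormalBasis_normalizedVector (k := k) he (hχ s).norm_eq_one
  have hstd (s : K) (x y : V) :
      ‖inner 𝕜 (EuclideanSpace.basisFun V 𝕜 x) (b s y)‖ ^ 2 = 1 / (Fintype.card V : ℝ) := by
    rw [hb]
    exact norm_inner_basisFun_normalizedVector_sq ((hχ s).mul_addChar _).norm_eq_one x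
  refine exists_isMUB_of_orthonormalBasis hm
    (B := fun o => o.elim (EuclideanSpace.basisFun V 𝕜) b) ?_
  rintro (_ | s) (_ | t) hst x y
  · exact absurd rfl hst
  · exact hstd t x y
  · rw [norm_inner_symm]
    exact hstd s y x
  · rw [Option.elim_some, Option.elim_some, hb, hb]
    exact norm_inner_normalizedVector_sq he ((hχ s).mul_addChar _) ((hχ t).mul_addChar _)
      (hβ t s fun hts => hst (congrArg some hts.symm))

end UnbiasedBases

section TraceForm

lemma exists_isQuadraticRefinement_complex {p : ℕ} [Fact p.Prime] {V : Type*} [AddCommGroup V]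
    [Module (ZMod p) V] [FiniteDimensional (ZMod p) V] (e : AddChar (ZMod p) ℂ)
    {β : LinearMap.BilinForm (ZMod p) V} (hβ : β.IsSymm) :
    ∃ χ, IsQuadraticRefinement e β χ := by
  by_cases hp : p = 2
  · subst hp
    exact exists_isQuadraticRefinement_zmod_two e hβ
  · exact exists_isQuadraticRefinement_of_isSymm e hβ
      (Ring.two_ne_zero (by rwa [ZMod.ringChar_zmod_n]))

variable (k : Type*) {F : Type*} [Field k] [Field F] [Algebra k F]

/-- The symmetric bilinear form `(x, y) ↦ tr (s x y)`. -/
def scaledTraceForm (s : F) : LinearMap.BilinForm k F :=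
  (Algebra.traceForm k F).compLeft (LinearMap.mulLeft k s)

lemma scaledTraceForm_apply (s x y : F) :
    scaledTraceForm k s x y = Algebra.trace k F (s * x * y) := rfl

lemma isSymm_scaledTraceForm (s : F) : (scaledTraceForm k s).IsSymm where
  eq x y := by
    rw [scaledTraceForm_apply, scaledTraceForm_apply, mul_right_comm]

variable {k} [FiniteDimensional k F] [Algebra.IsSeparable k F]

lemma eq_zero_of_trace_mul_eq_zero {y : F} (h : ∀ x, Algebra.trace k F (x * y) = 0) : y = 0 :=
  (traceForm_nondegenerate k F).2 y h

lemma separatingRight_scaledTraceForm_sub {s t : F} (hst : s ≠ t) :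
    (scaledTraceForm k s - scaledTraceForm k t).SeparatingRight := by
  intro y hy
  have hzero : (s - t) * y = 0 := eq_zero_of_trace_mul_eq_zero (k := k) fun x => by
    rw [← hy x, LinearMap.sub_apply, LinearMap.sub_apply, scaledTraceForm_apply,
      scaledTraceForm_apply, ← map_sub]
    congr 1
    ring
  exact (mul_eq_zero.1 hzero).resolve_left (sub_ne_zero.2 hst)

end TraceForm

lemma IsMUB.comp {𝕜 : Type*} [RCLike 𝕜] {m : ℕ} {κ κ' : Type*}
    {B : κ → OrthonormalBasis (Fin m) 𝕜 (EuclideanSpace 𝕜 (Fin m))} (hB : IsMUB B)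
    {f : κ' → κ} (hf : f.Injective) : IsMUB (B ∘ f) :=
  fun _ _ hk => hB _ _ (hf.ne hk)

theorem exists_isMUB_complex_of_field (F : Type*) [Field F] [Fintype F] :
    ∃ B : Option F → OrthonormalBasis (Fin (Fintype.card F)) ℂ
      (EuclideanSpace ℂ (Fin (Fintype.card F))), IsMUB B := by
  obtain ⟨p, hchar⟩ := CharP.exists F
  have : Fact p.Prime := ⟨CharP.char_is_prime F p⟩
  let : Algebra (ZMod p) F := ZMod.algebra F p
  have he : (ZMod.stdAddChar : AddChar (ZMod p) ℂ) ≠ 1 := fun h =>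
    one_ne_zero (ZMod.injective_stdAddChar (N := p) (by simp only [h, AddChar.one_apply]))
  exact exists_isMUB_of_isQuadraticRefinement rfl he
    (fun s t hst => separatingRight_scaledTraceForm_sub hst)
    fun s => exists_isQuadraticRefinement_complex _ (isSymm_scaledTraceForm (ZMod p) s)

theorem exists_isMUB_complex {m : ℕ} (hm : IsPrimePow m) :
    ∃ B : Fin (m + 1) → OrthonormalBasis (Fin m) ℂ (EuclideanSpace ℂ (Fin m)), IsMUB B := by
  obtain ⟨p, n, hp, hn, rfl⟩ := (isPrimePow_nat_iff m).1 hm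
  have : Fact p.Prime := ⟨hp⟩
  let F := GaloisField p n
  have : Fintype F := Fintype.ofFinite F
  have hcard : Fintype.card F = p ^ n := by
    rw [← Nat.card_eq_fintype_card, GaloisField.card p n hn.ne']
  obtain ⟨B, hB⟩ := exists_isMUB_complex_of_field F
  rw [← hcard]
  let σ : Fin (Fintype.card F + 1) ≃ Option F :=
    Fintype.equivOfCardEq (by rw [Fintype.card_fin, Fintype.card_option])
  exact ⟨B ∘ σ, hB.comp σ.injective⟩

section Kerdock

variable {F : Type*} [Field F] [Algebra (ZMod 2) F]

/-- The linear form `(x, c) ↦ tr (s x) + c` on `F × ZMod 2`. -/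
def kerdockDual (s : F) : Dual (ZMod 2) (F × ZMod 2) :=
  (Algebra.trace (ZMod 2) F ∘ₗ LinearMap.mulLeft (ZMod 2) s).coprod LinearMap.id

/-- The bilinear form of the classical Kerdock set with parameter `s`. The form
`tr (s x * s y)` on `F` is not alternating; the two rank one terms, which involve the extra
coordinate, make it so. -/
def kerdockForm (s : F) : LinearMap.BilinForm (ZMod 2) (F × ZMod 2) :=
  (Algebra.traceForm (ZMod 2) F).comp (LinearMap.mulLeft (ZMod 2) s ∘ₗ LinearMap.fst _ _ _)
      (LinearMap.mulLeft (ZMod 2) s ∘ₗ LinearMap.fst _ _ _) +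
    LinearMap.BilinForm.linMulLin (kerdockDual s) (kerdockDual s) -
    LinearMap.BilinForm.linMulLin (LinearMap.snd _ _ _) (LinearMap.snd _ _ _)

lemma kerdockDual_apply (s : F) (v : F × ZMod 2) :
    kerdockDual s v = Algebra.trace (ZMod 2) F (s * v.1) + v.2 := rfl

lemma kerdockForm_apply (s : F) (v w : F × ZMod 2) :
    kerdockForm s v w = Algebra.trace (ZMod 2) F (s * v.1 * (s * w.1)) +
      kerdockDual s v * kerdockDual s w - v.2 * w.2 := rfl

lemma trace_sq_zmod_two [Finite F] (x : F) :
    Algebra.trace (ZMod 2) F (x ^ 2) = Algebra.trace (ZMod 2) F x := by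
  simpa using
    Algebra.trace_eq_of_algEquiv (FiniteField.frobeniusAlgEquivOfAlgebraic (ZMod 2) F) x

lemma isAlt_kerdockForm [Finite F] (s : F) : (kerdockForm s).IsAlt := by
  intro v
  have hzero : ∀ a c : ZMod 2, a + (a + c) * (a + c) - c * c = 0 := by decide
  rw [kerdockForm_apply, kerdockDual_apply, ← sq, trace_sq_zmod_two, hzero]

lemma kerdockDual_eq_of_kerdockForm_eq {s t : F} {w : F × ZMod 2}
    (h : ∀ v, kerdockForm s v w = kerdockForm t v w) : kerdockDual s w = kerdockDual t w := by
  simpa [kerdockForm_apply, kerdockDual_apply s (0, 1), kerdockDual_apply t (0, 1)] using h (0, 1)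

lemma sub_mul_fst_eq_of_kerdockForm_eq [Finite F] {s t : F} (hst : s ≠ t) {w : F × ZMod 2}
    (h : ∀ v, kerdockForm s v w = kerdockForm t v w) :
    (s - t) * w.1 = algebraMap (ZMod 2) F (kerdockDual t w) := by
  have : CharP F 2 := charP_of_injective_algebraMap (algebraMap (ZMod 2) F).injective 2
  set c := kerdockDual t w
  suffices hprod : (s - t) * ((s - t) * w.1 - algebraMap (ZMod 2) F c) = 0 from
    sub_eq_zero.1 ((mul_eq_zero.1 hprod).resolve_left (sub_ne_zero.2 hst))
  refine eq_zero_of_trace_mul_eq_zero (k := ZMod 2) fun x => ?_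
  have hexpand : x * ((s - t) * ((s - t) * w.1 - algebraMap (ZMod 2) F c)) =
      s * x * (s * w.1) + c • (s * x) - (t * x * (t * w.1) + c • (t * x)) := by
    rw [Algebra.smul_def, Algebra.smul_def]
    linear_combination
      x * (s - t) * (-t * w.1 - algebraMap (ZMod 2) F c) * CharTwo.two_eq_zero (R := F)
  have hx := h (x, 0)
  simp only [kerdockForm_apply, kerdockDual_eq_of_kerdockForm_eq h, kerdockDual_apply _ (x, 0),
    add_zero, zero_mul, sub_zero] at hx
  rw [hexpand, map_sub, map_add, map_add, map_smul, map_smul, smul_eq_mul, smul_eq_mul]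
  linear_combination hx

lemma separatingRight_kerdockForm_sub [Finite F] (hodd : Odd (finrank (ZMod 2) F)) {s t : F}
    (hst : s ≠ t) : (kerdockForm s - kerdockForm t).SeparatingRight := by
  intro w hw
  have h (v) : kerdockForm s v w = kerdockForm t v w := sub_eq_zero.1 (hw v)
  have hfst := sub_mul_fst_eq_of_kerdockForm_eq hst h
  -- The trace of a constant is that constant because the degree is odd.
  have hdual : kerdockDual t w = 0 := by
    have htrace := congrArg (Algebra.trace (ZMod 2) F) hfst
    rw [Algebra.trace_algebraMap, nsmul_eq_mul, ZMod.natCast_eq_one_iff_odd.2 hodd,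
      one_mul, sub_mul, map_sub] at htrace
    rw [← htrace]
    exact sub_eq_zero.2 (add_right_cancel (kerdockDual_eq_of_kerdockForm_eq h))
  have hfst0 : w.1 = 0 := by
    rw [hdual, map_zero] at hfst
    exact (mul_eq_zero.1 hfst).resolve_left (sub_ne_zero.2 hst)
  have hsnd0 : w.2 = 0 := by
    simpa [hfst0, kerdockDual_apply] using hdual
  exact Prod.ext hfst0 hsnd0

theorem exists_isMUB_real_of_odd_finrank [Fintype F] (hodd : Odd (finrank (ZMod 2) F)) :
    ∃ B : Option F → OrthonormalBasis (Fin (Fintype.card F * 2)) ℝ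
      (EuclideanSpace ℝ (Fin (Fintype.card F * 2))), IsMUB B := by
  let e : AddChar (ZMod 2) ℝ := AddChar.zmodChar 2 (ζ := -1) (by norm_num)
  have he : e ≠ 1 :=
    AddChar.ne_one_iff.2 ⟨1, by norm_num [e, AddChar.zmodChar_apply, ZMod.val_one]⟩
  have hcard : Fintype.card (F × ZMod 2) = Fintype.card F * 2 := by
    rw [Fintype.card_prod, ZMod.card]
  exact exists_isMUB_of_isQuadraticRefinement hcard he
    (fun s t hst => separatingRight_kerdockForm_sub hodd hst)
    fun s => exists_isQuadraticRefinement_of_isAlt e (isAlt_kerdockForm s)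

end Kerdock

theorem exists_isMUB_real {a : ℕ} (ha : 1 ≤ a) :
    ∃ B : Fin (4 ^ a / 2 + 1) → OrthonormalBasis (Fin (4 ^ a)) ℝ (EuclideanSpace ℝ (Fin (4 ^ a))),
      IsMUB B := by
  have hn : 2 * a - 1 ≠ 0 := by lia
  let F := GaloisField 2 (2 * a - 1)
  have : Fintype F := Fintype.ofFinite F
  have hcard : Fintype.card F * 2 = 4 ^ a := by
    rw [← Nat.card_eq_fintype_card, GaloisField.card 2 _ hn, ← pow_succ,
      Nat.sub_add_cancel (by lia), pow_mul]
    rfl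
  have hodd : Odd (finrank (ZMod 2) F) := by
    rw [GaloisField.finrank 2 hn]
    exact ⟨a - 1, by lia⟩
  obtain ⟨B, hB⟩ := exists_isMUB_real_of_odd_finrank hodd
  rw [← hcard, Nat.mul_div_cancel _ two_pos]
  let σ : Fin (Fintype.card F + 1) ≃ Option F :=
    Fintype.equivOfCardEq (by rw [Fintype.card_fin, Fintype.card_option])
  exact ⟨B ∘ σ, hB.comp σ.injective⟩

end MixedPacking

end

theorem corollary6_general (m : ℕ) :
    ((∃ a : ℕ, 1 ≤ a ∧ m = 4 ^ a) →
      ∃ B : Fin (m / 2 + 1) → OrthonormalBasis (Fin m) ℝ (EuclideanSpace ℝ (Fin m)),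
        MixedPacking.IsMUB B) ∧
    (IsPrimePow m →
      ∃ B : Fin (m + 1) → OrthonormalBasis (Fin m) ℂ (EuclideanSpace ℂ (Fin m)),
        MixedPacking.IsMUB B) ∧
    (2 ≤ m → ∀ (l₁ lam₁ l₂ lam₂ : ℕ) (S₁ S₂ : Finset (Finset (Fin m))),
      MixedPacking.IsSymmetricDesign l₁ lam₁ S₁ → MixedPacking.IsSymmetricDesign l₂ lam₂ S₂ →
      l₁ ≠ l₂ →
        (Even m →
          ∀ B : Fin (m / 2 + 1) → OrthonormalBasis (Fin m) ℝ (EuclideanSpace ℝ (Fin m)),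
            MixedPacking.IsMUB B →
            ∀ A₁ A₂ : Finset (Fin (m / 2 + 1)), MixedPacking.IsTwoPartition A₁ A₂ →
              MixedPacking.IsTightOptimalMixedPacking
                (MixedPacking.unionFamily B A₁ A₂ S₁ S₂) 2) ∧
        ∀ B : Fin (m + 1) → OrthonormalBasis (Fin m) ℂ (EuclideanSpace ℂ (Fin m)),
          MixedPacking.IsMUB B →
          ∀ A₁ A₂ : Finset (Fin (m + 1)), MixedPacking.IsTwoPartition A₁ A₂ →
            MixedPacking.IsTightOptimalMixedPacking
              (MixedPacking.unionFamily B A₁ A₂ S₁ S₂) 2) := by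
  refine ⟨?_, MixedPacking.exists_isMUB_complex, fun hm l₁ lam₁ l₂ lam₂ S₁ S₂ hS₁ hS₂ hl =>
    ⟨fun heven B hB A₁ A₂ hA => ?_, fun B hB A₁ A₂ hA => ?_⟩⟩
  · rintro ⟨a, ha, rfl⟩
    exact MixedPacking.exists_isMUB_real ha
  · refine MixedPacking.isTightOptimalMixedPacking_unionFamily_real ?_ hm hS₁ hS₂ hl hB hA
    rw [Fintype.card_fin, mul_add, Nat.two_mul_div_two_of_even heven]
    lia
  · refine MixedPacking.isTightOptimalMixedPacking_unionFamily_of_lt_card ?_ hm hS₁ hS₂ hl hB hA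
    rw [Fintype.card_fin]
    lia

theorem corollary6 (m : ℕ) :
    -- the real case: `m` is a power of `4`
    ((∃ a : ℕ, 1 ≤ a ∧ m = 4 ^ a) →
      (∃ B : Fin (m / 2 + 1) → OrthonormalBasis (Fin m) ℝ (EuclideanSpace ℝ (Fin m)),
        MixedPacking.IsMUB B) ∧
      ∀ (l lam : ℕ) (S : Finset (Finset (Fin m))), MixedPacking.IsSymmetricDesign l lam S →
        ∀ B : Fin (m / 2 + 1) → OrthonormalBasis (Fin m) ℝ (EuclideanSpace ℝ (Fin m)),
          MixedPacking.IsMUB B →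
          ∀ A₁ A₂ : Finset (Fin (m / 2 + 1)), MixedPacking.IsTwoPartition A₁ A₂ →
            MixedPacking.IsTightOptimalMixedPacking
              (MixedPacking.unionFamily B A₁ A₂ S (MixedPacking.complDesign S)) 2) ∧
    -- the complex case: `m` is a prime power
    (IsPrimePow m →
      (∃ B : Fin (m + 1) → OrthonormalBasis (Fin m) ℂ (EuclideanSpace ℂ (Fin m)),
        MixedPacking.IsMUB B) ∧
      -- for `m = 2` the only symmetric design `{{1}, {2}}` is its own complement
      (m ≠ 2 →
        ∀ (l lam : ℕ) (S : Finset (Finset (Fin m))), MixedPacking.IsSymmetricDesign l lam S →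
          ∀ B : Fin (m + 1) → OrthonormalBasis (Fin m) ℂ (EuclideanSpace ℂ (Fin m)),
            MixedPacking.IsMUB B →
            ∀ A₁ A₂ : Finset (Fin (m + 1)), MixedPacking.IsTwoPartition A₁ A₂ →
              MixedPacking.IsTightOptimalMixedPacking
                (MixedPacking.unionFamily B A₁ A₂ S (MixedPacking.complDesign S)) 2)) := by
  obtain ⟨hreal, hcomplex, hpacking⟩ := corollary6_general m
  refine ⟨fun hm => ⟨hreal hm, fun l lam S hS => ?_⟩,
    fun hm => ⟨hcomplex hm, fun hm2 l lam S hS => ?_⟩⟩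
  · obtain ⟨a, ha, rfl⟩ := hm
    have hm4 : 4 ≤ 4 ^ a := Nat.le_self_pow (by lia) 4
    have heven : Even (4 ^ a) := (by decide : Even 4).pow_of_ne_zero (by lia)
    exact (hpacking (by lia) _ _ _ _ _ _ hS hS.complDesign (hS.ne_sub_self (by lia))).1 heven
  · have hm3 : 2 < m := lt_of_le_of_ne hm.two_le hm2.symm
    exact (hpacking hm3.le _ _ _ _ _ _ hS hS.complDesign (hS.ne_sub_self hm3)).2
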